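/- Let $P$ be the two-way infinite path, with vertex set $\mathbb{Z}$ and consecutive integers adjacent. For $n\ge 1$ let $(\times P)^n$ be the $n$-fold tensor product of $P$: its vertex set is $\mathbb{Z}^n$, and $x,y$ are adjacent if and only if $|x_i-y_i|=1$ for all $1\le i\le n$. A vertex coloring $c$ of a graph is nonrepetitive if there are no $k\ge 1$ and no path $v_1,\dots,v_{2k}$ (with distinct vertices) such that $c(v_i)=c(v_{k+i})$ for all $1\le i\le k$; $\pi(G)$ denotes the least number of colors in a nonrepetitive coloring of $G$. A palindrome-free Thue sequence is a map $T:\mathbb{Z}\to[4]$ that is a nonrepetitive coloring of $P$ and in which no block of at least two consecutive terms equals its own reversal. **Theorem 4.** For every $n\ge 1$, $$\pi\big((\times P)^n\big)\le 4^{n-1}+4\cdot 2^{n-1}.$$ Moreover, palindrome-free Thue sequences exist, and for any palindrome-free Thue sequences $T,S_1,\dots,S_{n-1}$ there is a nonrepetitive coloring $c$ of $(\times P)^n$ with color set the disjoint union $\big([4]\times[2^{n-1}]\big)\sqcup[4]^{n-1}$ of the following form: if $x_n$ is odd, then $c(x)=(T(\tfrac{x_n-1}{2}),r)$ for some $r\in[2^{n-1}]$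 (depending on $x$), and if $x_n$ is even, then $c(x)=(S_1(\lfloor x_1/2\rfloor),\dots,S_{n-1}(\lfloor x_{n-1}/2\rfloor))$. -/

import Mathlib

/-- The two-way infinite path: the vertices are the integers, and consecutive integers are
adjacent. -/
noncomputable abbrev infinitePath : SimpleGraph ℤ := SimpleGraph.hasse ℤ

/-- The tensor product of `n` copies of `G`: two tuples are adjacent iff they are adjacent in
every coordinate. The clause `x ≠ y` only serves to exclude a loop in the empty product `n = 0`;
see `tensorPow_adj`. -/
def tensorPow {V : Type*} (G : SimpleGraph V) (n : ℕ) : SimpleGraph (Fin n → V) where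
  Adj x y := x ≠ y ∧ ∀ i, G.Adj (x i) (y i)
  symm := ⟨fun _ _ h => ⟨h.1.symm, fun i => (h.2 i).symm⟩⟩
  loopless := ⟨fun _ h => h.1 rfl⟩

theorem tensorPow_adj {V : Type*} (G : SimpleGraph V) {n : ℕ} (hn : 1 ≤ n) (x y : Fin n → V) :
    (tensorPow G n).Adj x y ↔ ∀ i, G.Adj (x i) (y i) := by
  refine ⟨fun h => h.2, fun h => ⟨?_, h⟩⟩
  rintro rfl
  exact (h ⟨0, hn⟩).ne rfl

/-- A vertex coloring `c` is nonrepetitive if no path on `2k` vertices `v₀, …, v_{2k-1}`, `k ≥ 1`,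
satisfies `c(vᵢ) = c(v_{k+i})` for all `i < k`. -/
def IsNonrepetitive {V α : Type*} (G : SimpleGraph V) (c : V → α) : Prop :=
  ∀ ⦃u w : V⦄ (p : G.Walk u w), p.IsPath → ∀ k : ℕ, 1 ≤ k → p.length + 1 = 2 * k →
    ¬ ∀ i < k, c (p.getVert i) = c (p.getVert (k + i))

/-- The nonrepetitive chromatic number (Thue number) of `G`: the least number of colors in a
nonrepetitive coloring, and `⊤` if finitely many colors do not suffice. -/
noncomputable def thueNumber {V : Type*} (G : SimpleGraph V) : ℕ∞ :=
  ⨅ m ∈ {m : ℕ | ∃ c : V → Fin m, IsNonrepetitive G c}, (m : ℕ∞)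

/-- A palindrome-free Thue sequence: a nonrepetitive 4-coloring of the infinite path in which no
block of at least two consecutive terms equals its own reflection. -/
structure IsPalindromeFreeThue (T : ℤ → Fin 4) : Prop where
  nonrepetitive : IsNonrepetitive infinitePath T
  palindromeFree : ∀ (a : ℤ) (m : ℕ), 2 ≤ m →
    ¬ ∀ i : ℕ, i < m → T (a + i) = T (a + (m - 1) - i)

/-! The key is rigidity: a square-free sequence without factors `aba` is injective on any three
consecutive integers, so colors determine a lazy walk up to an isometry of the line. If such a walk
reads a square, its two halves visit the same vertices in the same order
(`IsSquareFreeSeq.eq_of_lazyWalk`). In the tensor power every coordinate changes parity at each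
step, so every second vertex of a path, halved in one coordinate, is a lazy walk. On a repetitive
path, rigidity for `T` makes the last coordinate agree at two corresponding vertices of odd type.
Rigidity for the `S i` makes the other coordinates agree at neighboring vertices of even type, which
leaves two candidates, differing by 2, for each coordinate at the odd vertices. The binary digits
stored in `r` separate these, so a vertex repeats (`tensorColoring_isNonrepetitive`). A suitable
sequence arises from the square-free difference sequence of Thue–Morse by inserting a fourth letter
that destroys the factors `aba`. -/

/-! ### Repetitions and palindromes along walks on the integers -/

/-- `T` has no block of the form `ww` with `w` nonempty. -/
def IsSquareFreeSeq {α : Type*} (T : ℤ → α) : Prop :=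
  ∀ (a : ℤ) (p : ℕ), 1 ≤ p → ¬ ∀ i : ℕ, i < p → T (a + i) = T (a + p + i)

/-- The steps of `f` among the indices below `k` have size at most one. -/
def IsLazyWalk (f : ℕ → ℤ) (k : ℕ) : Prop :=
  ∀ i, i + 1 < k → |f (i + 1) - f i| ≤ 1

theorem IsLazyWalk.mono {f : ℕ → ℤ} {k l : ℕ} (h : IsLazyWalk f k) (hl : l ≤ k) :
    IsLazyWalk f l := fun i hi => h i (by omega)

theorem IsLazyWalk.exists_eq_of_le_of_le {f : ℕ → ℤ} {k : ℕ} (hf : IsLazyWalk f k) {i j : ℕ}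
    (hij : i ≤ j) (hj : j < k) {x : ℤ} (hx : f i ≤ x ∧ x ≤ f j ∨ f j ≤ x ∧ x ≤ f i) :
    ∃ l < k, f l = x := by
  induction j, hij using Nat.le_induction with
  | base => exact ⟨i, hj, by omega⟩
  | succ j _ ih =>
    have hstep := abs_le.mp (hf j hj)
    by_cases h : f (j + 1) = x
    · exact ⟨j + 1, hj, h⟩
    · exact ih (by omega) (by omega)

theorem IsLazyWalk.exists_eq_of_mem_Icc {f : ℕ → ℤ} {k : ℕ} (hf : IsLazyWalk f k) {i j : ℕ}
    (hi : i < k) (hj : j < k) {x : ℤ} (h₁ : f i ≤ x) (h₂ : x ≤ f j) :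
    ∃ l < k, f l = x := by
  rcases le_total i j with h | h
  · exact hf.exists_eq_of_le_of_le h hj (Or.inl ⟨h₁, h₂⟩)
  · exact hf.exists_eq_of_le_of_le h hi (Or.inr ⟨h₁, h₂⟩)

section Rigidity

variable {α : Type*} {T : ℤ → α}

theorem IsSquareFreeSeq.ne_add_one (hT : IsSquareFreeSeq T) (x : ℤ) : T x ≠ T (x + 1) := by
  intro h
  refine hT x 1 le_rfl fun i hi => ?_
  obtain rfl : i = 0 := by omega
  simpa using h

theorem IsSquareFreeSeq.eq_of_abs_sub_le_two (hT : IsSquareFreeSeq T)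
    (hT₂ : ∀ x, T x ≠ T (x + 2)) {x y : ℤ} (hxy : |x - y| ≤ 2) (h : T x = T y) : x = y := by
  rw [abs_le] at hxy
  obtain h' | h' | h' | h' | h' :
      x = y ∨ y = x + 1 ∨ y = x + 2 ∨ x = y + 1 ∨ x = y + 2 := by omega
  · exact h'
  · exact absurd (h' ▸ h) (hT.ne_add_one x)
  · exact absurd (h' ▸ h) (hT₂ x)
  · exact absurd (h' ▸ h).symm (hT.ne_add_one y)
  · exact absurd (h' ▸ h).symm (hT₂ y)

/-- Two lazy walks with the same colors differ by a translation or a reflection. -/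
theorem IsLazyWalk.exists_isometry {f g : ℕ → ℤ}
    (hinj : ∀ x y : ℤ, |x - y| ≤ 2 → T x = T y → x = y) (k : ℕ)
    (hf : IsLazyWalk f k) (hg : IsLazyWalk g k) (hfg : ∀ i < k, T (f i) = T (g i)) :
    ∃ e : ℤ, (e = 1 ∨ e = -1) ∧ ∀ i < k, g i = g 0 + e * (f i - f 0) := by
  induction k with
  | zero => exact ⟨1, Or.inl rfl, fun i hi => absurd hi (by omega)⟩
  | succ k ih =>
    obtain ⟨e, he, hge⟩ := ih (hf.mono k.le_succ) (hg.mono k.le_succ) fun i hi => hfg i (by omega)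
    rcases k with _ | k
    · refine ⟨1, Or.inl rfl, fun i hi => ?_⟩
      obtain rfl : i = 0 := by omega
      ring
    have hfs := abs_le.mp (hf k (by omega))
    have hgs := abs_le.mp (hg k (by omega))
    have hTs := hfg (k + 1) (by omega)
    -- the two walks return together to vertices near the present one
    have key : ∀ l ≤ k, |f l - f k| ≤ 1 → |g l - g k| ≤ 1 →
        (f (k + 1) = f l ↔ g (k + 1) = g l) := by
      intro l hl h₁ h₂
      rw [abs_le] at h₁ h₂
      have hTl := hfg l (by omega)
      constructor
      · intro h
        refine hinj _ _ (abs_le.mpr ⟨by omega, by omega⟩) ?_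
        rw [← hTs, ← hTl, h]
      · intro h
        refine hinj _ _ (abs_le.mpr ⟨by omega, by omega⟩) ?_
        rw [hTs, hTl, h]
    have hkk := key k le_rfl (by simp) (by simp)
    have hgk := hge k (by omega)
    by_cases hconst : ∀ i ≤ k, f i = f 0
    · have hgc : ∀ i ≤ k, g i = g 0 := fun i hi => by
        rw [hge i (by omega), hconst i hi]; ring
      have h₁ := hconst k le_rfl
      have h₂ := hgc k le_rfl
      -- While the walks stand still the sign is free. By `hkk` they leave together, and the first
      -- move fixes it.
      refine ⟨if f (k + 1) - f k = g (k + 1) - g k then 1 else -1, by split_ifs <;> simp, ?_⟩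
      intro i hi
      rcases Nat.lt_succ_iff_lt_or_eq.mp hi with hi | rfl
      · rw [hconst i (by omega), hgc i (by omega)]; ring
      · split_ifs <;> omega
    · push Not at hconst
      obtain ⟨i, hik, hi⟩ := hconst
      -- Having moved, `f` has already visited a neighbor of `f k`. Testing the next vertex against
      -- `f k` and this neighbor singles it out among the three possibilities, for `f` and `g`
      -- alike.
      obtain ⟨l, hl, hfl⟩ : ∃ l < k + 1, f l = f k + 1 ∨ f l = f k - 1 := by
        have hf' : IsLazyWalk f (k + 1) := hf.mono (by omega)
        obtain ⟨j, hj, hjk⟩ : ∃ j ≤ k, f j ≠ f k := by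
          by_cases h : f i = f k
          · exact ⟨0, by omega, by omega⟩
          · exact ⟨i, hik, h⟩
        rcases lt_or_gt_of_ne hjk with h | h
        · obtain ⟨l, hl, h'⟩ := hf'.exists_eq_of_mem_Icc (i := j) (j := k) (x := f k - 1)
            (by omega) (by omega) (by omega) (by omega)
          exact ⟨l, hl, Or.inr h'⟩
        · obtain ⟨l, hl, h'⟩ := hf'.exists_eq_of_mem_Icc (i := k) (j := j) (x := f k + 1)
            (by omega) (by omega) (by omega) (by omega)
          exact ⟨l, hl, Or.inl h'⟩
      have hgl := hge l hl
      refine ⟨e, he, fun i hi => ?_⟩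
      rcases Nat.lt_succ_iff_lt_or_eq.mp hi with hi | rfl
      · exact hge i hi
      · have hkl := key l (by omega) (abs_le.mpr ⟨by omega, by omega⟩)
          (abs_le.mpr (by rcases he with rfl | rfl <;> constructor <;> omega))
        rcases he with rfl | rfl <;> omega

/-- In a square-free sequence without factors `aba`, a lazy walk that reads a square traverses
the same vertices twice. -/
theorem IsSquareFreeSeq.eq_of_lazyWalk (hT : IsSquareFreeSeq T) (hT₂ : ∀ x, T x ≠ T (x + 2))
    {f : ℕ → ℤ} {k : ℕ} (hf : IsLazyWalk f (2 * k))
    (hrep : ∀ i < k, T (f i) = T (f (k + i))) : ∀ i < k, f i = f (k + i) := by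
  intro i₀ hi₀
  have hk : 0 < k := by omega
  have hfk : IsLazyWalk f k := hf.mono (by omega)
  obtain ⟨e, he, hge⟩ := IsLazyWalk.exists_isometry (g := fun i => f (k + i))
    (fun x y => hT.eq_of_abs_sub_le_two hT₂) k hfk
    (fun i hi => hf (k + i) (by omega)) hrep
  simp only [add_zero] at hge
  obtain ⟨m, hm, hmin⟩ := (Finset.range k).exists_min_image f ⟨0, by simpa⟩
  obtain ⟨M, hM, hmax⟩ := (Finset.range k).exists_max_image f ⟨0, by simpa⟩
  simp only [Finset.mem_range] at hm hmin hM hmax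
  have hsurj : ∀ x, f m ≤ x → x ≤ f M → ∃ l < k, f l = x := fun x h₁ h₂ =>
    hfk.exists_eq_of_mem_Icc hm hM h₁ h₂
  have hcontact : |f k - f (k - 1)| ≤ 1 := by
    have := hf (k - 1) (by omega)
    rwa [Nat.sub_add_cancel hk] at this
  rw [abs_le] at hcontact
  have h0m := hmin 0 hk
  have h0M := hmax 0 hk
  have hlm := hmin (k - 1) (by omega)
  have hlM := hmax (k - 1) (by omega)
  rcases he with rfl | rfl
  · obtain ⟨d, hd⟩ : ∃ d, d = f k - f 0 := ⟨_, rfl⟩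
    have htrans : ∀ x, f m ≤ x → x ≤ f M → T x = T (x + d) := by
      intro x h₁ h₂
      obtain ⟨l, hl, rfl⟩ := hsurj x h₁ h₂
      rw [hrep l hl, hge l hl]
      congr 1
      omega
    have hi := hge i₀ hi₀
    -- The vertex `f k = f 0 + d` is within 1 of `f (k - 1)`, so the range of the first half has at
    -- least `|d|` vertices. If `d ≠ 0`, this range and its translate contain a square of period
    -- `|d|`.
    rcases lt_trichotomy d 0 with h | h | h
    · refine absurd (fun i hi => ?_) (hT (f m + d) d.natAbs (by omega))
      rw [show f m + d + (d.natAbs : ℤ) + i = f m + i by omega,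
        htrans (f m + i) (by omega) (by omega)]
      congr 1
      omega
    · omega
    · refine absurd (fun i hi => ?_) (hT (f m) d.natAbs (by omega))
      rw [htrans (f m + i) (by omega) (by omega)]
      congr 1
      omega
  · obtain ⟨s, hs⟩ : ∃ s, s = f k + f 0 := ⟨_, rfl⟩
    have hrefl : ∀ x, f m ≤ x → x ≤ f M → |2 * x - s| ≤ 2 → 2 * x = s := by
      intro x h₁ h₂ h₃
      rw [abs_le] at h₃
      have := hT.eq_of_abs_sub_le_two hT₂ (x := x) (y := s - x)
        (abs_le.mpr ⟨by omega, by omega⟩) (by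
          obtain ⟨l, hl, rfl⟩ := hsurj x h₁ h₂
          rw [hrep l hl, hge l hl]
          congr 1
          omega)
      omega
    have hc : ∀ x, f m ≤ x → x ≤ f M → -2 ≤ 2 * x - s → 2 * x - s ≤ 2 → 2 * x = s :=
      fun x h₁ h₂ h₃ h₄ => hrefl x h₁ h₂ (abs_le.mpr ⟨h₃, h₄⟩)
    -- The reflection sends `f 0` to `f k`, next to or at `f (k - 1)`, so the range comes near the
    -- center `s / 2`. With two or more vertices it would contain a vertex other than the center
    -- within distance 1 of it, against `hc`. The three instances cover both parities of `s`.
    have hmM : f m = f M := by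
      by_contra hne
      have h₁ := hc ((s + 1) / 2)
      have h₂ := hc ((s - 1) / 2)
      have h₃ := hc (s / 2 + 1)
      omega
    have h₀ := hc (f 0) h0m h0M (by omega) (by omega)
    have hi := hge i₀ hi₀
    have hi₁ := hmin i₀ hi₀
    have hi₂ := hmax i₀ hi₀
    omega

end Rigidity

/-! ### The infinite path -/

theorem infinitePath_adj {x y : ℤ} : infinitePath.Adj x y ↔ y = x + 1 ∨ x = y + 1 := by
  rw [infinitePath, SimpleGraph.hasse_adj, Order.covBy_iff_add_one_eq,
    Order.covBy_iff_add_one_eq]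
  constructor <;> rintro (h | h) <;> omega

theorem exists_increasing_walk (a : ℤ) (m : ℕ) :
    ∃ p : infinitePath.Walk a (a + m), p.length = m ∧ ∀ i ≤ m, p.getVert i = a + i := by
  induction m generalizing a with
  | zero =>
    refine ⟨SimpleGraph.Walk.nil.copy rfl (by simp), by simp, fun i hi => ?_⟩
    obtain rfl : i = 0 := by omega
    simp
  | succ m ih =>
    obtain ⟨p, hp, hv⟩ := ih (a + 1)
    refine ⟨(SimpleGraph.Walk.cons (infinitePath_adj.mpr (Or.inl rfl)) p).copy rfl
      (by push_cast; ring), by simp [hp], fun i hi => ?_⟩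
    rcases i with _ | i
    · simp
    · simp only [SimpleGraph.Walk.getVert_copy, SimpleGraph.Walk.getVert_cons_succ]
      rw [hv i (by omega)]
      push_cast
      ring

theorem IsNonrepetitive.isSquareFreeSeq {α : Type*} {T : ℤ → α}
    (hT : IsNonrepetitive infinitePath T) : IsSquareFreeSeq T := by
  intro a k hk hrep
  obtain ⟨p, hlen, hv⟩ := exists_increasing_walk a (2 * k - 1)
  have hpath : p.IsPath := by
    rw [← SimpleGraph.Walk.IsPath.getVert_injOn_iff]
    intro i hi j hj hij
    simp only [Set.mem_ofPred_eq, hlen] at hi hj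
    rw [hv i hi, hv j hj] at hij
    omega
  refine hT p hpath k hk (by omega) fun i hi => ?_
  rw [hv i (by omega), hv (k + i) (by omega), hrep i hi]
  congr 1
  push_cast
  ring

theorem IsSquareFreeSeq.isNonrepetitive {α : Type*} {T : ℤ → α} (hT : IsSquareFreeSeq T)
    (hT₂ : ∀ x, T x ≠ T (x + 2)) : IsNonrepetitive infinitePath T := by
  intro u w p hp k hk hlen hrep
  have hf : IsLazyWalk p.getVert (2 * k) := fun i hi => by
    have := infinitePath_adj.mp (p.adj_getVert_succ (i := i) (by omega))
    exact abs_le.mpr ⟨by omega, by omega⟩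
  have h := hT.eq_of_lazyWalk hT₂ hf hrep 0 hk
  have := hp.getVert_injOn (show 0 ∈ {i | i ≤ p.length} by simp)
    (show k + 0 ∈ {i | i ≤ p.length} by simp only [Set.mem_ofPred_eq]; omega) h
  omega

/-- Every palindrome contains a central one of length 2 or 3; length 2 is already a square, so only
the factors `aba` need excluding. -/
theorem isPalindromeFreeThue_iff {T : ℤ → Fin 4} :
    IsPalindromeFreeThue T ↔ IsSquareFreeSeq T ∧ ∀ x, T x ≠ T (x + 2) := by
  constructor
  · refine fun h => ⟨h.nonrepetitive.isSquareFreeSeq, fun x hx => ?_⟩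
    refine h.palindromeFree x 3 (by norm_num) fun i hi => ?_
    interval_cases i
    · simpa [show x + (3 - 1) = x + 2 by ring] using hx
    · congr 1
      norm_num [add_sub_assoc]
    · simpa [show x + (3 - 1) = x + 2 by ring] using hx.symm
  · rintro ⟨hT, hT₂⟩
    refine ⟨hT.isNonrepetitive hT₂, fun a m hm hpal => ?_⟩
    -- Index `m / 2 - 1` and its mirror image are the innermost pair, at distance 1 or 2 according
    -- to the parity of `m`.
    have := hT.eq_of_abs_sub_le_two hT₂ (abs_le.mpr ⟨by omega, by omega⟩)
      (hpal (m / 2 - 1) (by omega))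
    omega

/-! ### The Thue–Morse sequence and its two-sided extensions -/

/-- The Thue–Morse sequence: the parity of the binary digit sum. -/
def thueMorse : ℕ → Bool
  | 0 => false
  | n + 1 => xor (decide ((n + 1) % 2 = 1)) (thueMorse ((n + 1) / 2))
decreasing_by omega

theorem thueMorse_two_mul (n : ℕ) : thueMorse (2 * n) = thueMorse n := by
  rcases n with _ | n
  · rfl
  · rw [show 2 * (n + 1) = (2 * n + 1) + 1 by ring, thueMorse,
      show (2 * n + 1 + 1) / 2 = n + 1 by omega, show (2 * n + 1 + 1) % 2 = 0 by omega]
    simp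

theorem thueMorse_two_mul_add_one (n : ℕ) : thueMorse (2 * n + 1) = !thueMorse n := by
  rw [thueMorse, show (2 * n + 1) / 2 = n by omega, show (2 * n + 1) % 2 = 1 by omega]
  simp

/-- The two-sided extension of the Thue–Morse sequence by its mirror image, complemented
if `b` holds. -/
def twoSidedThueMorse (b : Bool) (n : ℤ) : Bool :=
  if 0 ≤ n then thueMorse n.toNat else xor b (thueMorse (-1 - n).toNat)

/-- On the negative side the mirror image turns even indices into odd ones, so doubling exchanges
the two extensions. Hence overlap-freeness is proved for both values of `b` at once. -/
theorem twoSidedThueMorse_two_mul (b : Bool) (n : ℤ) :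
    twoSidedThueMorse b (2 * n) = twoSidedThueMorse (!b) n := by
  unfold twoSidedThueMorse
  by_cases h : 0 ≤ n
  · rw [if_pos h, if_pos (by omega), show (2 * n).toNat = 2 * n.toNat by omega,
      thueMorse_two_mul]
  · rw [if_neg h, if_neg (by omega), show (-1 - 2 * n).toNat = 2 * (-1 - n).toNat + 1 by omega,
      thueMorse_two_mul_add_one]
    simp

theorem twoSidedThueMorse_two_mul_add_one (b : Bool) (n : ℤ) :
    twoSidedThueMorse b (2 * n + 1) = !twoSidedThueMorse (!b) n := by
  unfold twoSidedThueMorse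
  by_cases h : 0 ≤ n
  · rw [if_pos h, if_pos (by omega), show (2 * n + 1).toNat = 2 * n.toNat + 1 by omega,
      thueMorse_two_mul_add_one]
  · rw [if_neg h, if_neg (by omega), show (-1 - (2 * n + 1)).toNat = 2 * (-1 - n).toNat by omega,
      thueMorse_two_mul]
    simp

theorem twoSidedThueMorse_add_one_of_even (b : Bool) {n : ℤ} (hn : Even n) :
    twoSidedThueMorse b (n + 1) = !twoSidedThueMorse b n := by
  obtain ⟨j, rfl⟩ := hn
  rw [← two_mul, twoSidedThueMorse_two_mul, twoSidedThueMorse_two_mul_add_one]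

theorem twoSidedThueMorse_overlapFree (p : ℕ) (hp : 1 ≤ p) (b : Bool) (a : ℤ) :
    ¬ ∀ i : ℕ, i ≤ p → twoSidedThueMorse b (a + i) = twoSidedThueMorse b (a + i + p) := by
  induction p using Nat.strong_induction_on generalizing b a with
  | _ p ih =>
  intro h
  rcases Nat.even_or_odd' p with ⟨q, rfl | rfl⟩
  -- For an even period, the positions with the parity of `a` form an overlap of half the period in
  -- the other extension.
  · refine ih q (by omega) (by omega) (!b) (a / 2) fun i hi => ?_
    have hi' := h (2 * i) (by omega)
    rcases Int.emod_two_eq_zero_or_one a with ha | ha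
    · rw [show a + ((2 * i : ℕ) : ℤ) = 2 * (a / 2 + i) by omega,
        show 2 * (a / 2 + i) + ((2 * q : ℕ) : ℤ) = 2 * (a / 2 + i + q) by push_cast; ring] at hi'
      simpa only [twoSidedThueMorse_two_mul] using hi'
    · rw [show a + ((2 * i : ℕ) : ℤ) = 2 * (a / 2 + i) + 1 by omega,
        show 2 * (a / 2 + i) + 1 + ((2 * q : ℕ) : ℤ) = 2 * (a / 2 + i + q) + 1 by
          push_cast; ring] at hi'
      simpa only [twoSidedThueMorse_two_mul_add_one, Bool.not_inj_iff] using hi'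
  -- Terms at `2j` and `2j + 1` always differ. An odd period carries this over to the pairs starting
  -- at odd positions, so the word alternates, and terms at odd distance `p` cannot agree.
  · have halt : ∀ i : ℕ, i < 2 * q + 1 →
        twoSidedThueMorse b (a + i + 1) = !twoSidedThueMorse b (a + i) := by
      intro i hi
      rcases Int.even_or_odd (a + i) with he | ho
      · exact twoSidedThueMorse_add_one_of_even b he
      · have hi₁ := h (i + 1) (by omega)
        rw [Nat.cast_succ, ← add_assoc] at hi₁
        rw [h i (by omega), hi₁, add_right_comm]
        refine twoSidedThueMorse_add_one_of_even b (ho.add_odd ?_)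
        exact_mod_cast odd_two_mul_add_one q
    have hparity : ∀ i : ℕ, i ≤ 2 * q + 1 →
        twoSidedThueMorse b (a + i) = xor (decide (i % 2 = 1)) (twoSidedThueMorse b a) := by
      intro i
      induction i with
      | zero => simp
      | succ i ih =>
        intro hi
        rw [Nat.cast_succ, ← add_assoc, halt i (by omega), ih (by omega)]
        rcases Nat.mod_two_eq_zero_or_one i with h | h
        · rw [h, show (i + 1) % 2 = 1 by omega]; simp
        · rw [h, show (i + 1) % 2 = 0 by omega]; simp
    have h₀ := h 0 (by omega)
    have h₁ := hparity (2 * q + 1) le_rfl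
    rw [show (2 * q + 1) % 2 = 1 by omega] at h₁
    rw [Nat.cast_zero, add_zero, h₁] at h₀
    simp at h₀

/-! ### A palindrome-free Thue sequence -/

/-- The difference sequence of the two-sided Thue–Morse sequence, with values in `{0, 1, 2}`. -/
def thueMorseDiff (n : ℤ) : Fin 4 :=
  if twoSidedThueMorse false n = twoSidedThueMorse false (n + 1) then 1
  else if twoSidedThueMorse false n then 0 else 2

theorem thueMorseDiff_ne_three (n : ℤ) : thueMorseDiff n ≠ 3 := by
  unfold thueMorseDiff
  split_ifs <;> decide

theorem toInt_sub_eq_of_thueMorseDiff_eq {m n : ℤ} (h : thueMorseDiff m = thueMorseDiff n) :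
    (twoSidedThueMorse false (m + 1)).toInt - (twoSidedThueMorse false m).toInt =
      (twoSidedThueMorse false (n + 1)).toInt - (twoSidedThueMorse false n).toInt := by
  unfold thueMorseDiff at h
  generalize twoSidedThueMorse false (m + 1) = m₁ at *
  generalize twoSidedThueMorse false m = m₀ at *
  generalize twoSidedThueMorse false (n + 1) = n₁ at *
  generalize twoSidedThueMorse false n = n₀ at *
  revert h
  revert m₁ m₀ n₁ n₀
  decide

/-- A square of differences makes `t (n + p) - t n` a constant `c` for `a ≤ n ≤ a + p`. Adding the
two extreme cases gives `t (a + 2p) - t a = 2c`; as `t` is 0 or 1, `c = 0`, and `t` has an overlap.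
-/
theorem thueMorseDiff_isSquareFreeSeq : IsSquareFreeSeq thueMorseDiff := by
  intro a p hp h
  have hbound : ∀ b : Bool, 0 ≤ b.toInt ∧ b.toInt ≤ 1 := by decide
  have hinj : ∀ b b' : Bool, b.toInt = b'.toInt → b = b' := by decide
  have hconst : ∀ i : ℕ, i ≤ p →
      (twoSidedThueMorse false (a + i + p)).toInt - (twoSidedThueMorse false (a + i)).toInt =
        (twoSidedThueMorse false (a + p)).toInt - (twoSidedThueMorse false a).toInt := by
    intro i
    induction i with
    | zero => simp
    | succ i ih =>
      intro hi
      have h₁ := ih (by omega)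
      have h₂ := toInt_sub_eq_of_thueMorseDiff_eq (h i (by omega))
      rw [show a + (p : ℤ) + i = a + i + p by ring] at h₂
      rw [Nat.cast_succ, ← add_assoc, show a + (i : ℤ) + 1 + p = a + i + p + 1 by ring]
      omega
  have hp' := hconst p le_rfl
  have hb₁ := hbound (twoSidedThueMorse false (a + p + p))
  have hb₂ := hbound (twoSidedThueMorse false a)
  refine twoSidedThueMorse_overlapFree p hp false a fun i hi => hinj _ _ ?_
  have := hconst i hi
  omega

/-- The sequence `thueMorseDiff` with the letter `3` inserted after every second term. -/
def palindromeFreeSeq (n : ℤ) : Fin 4 :=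
  if n % 3 = 2 then 3 else thueMorseDiff (n - n / 3)

theorem palindromeFreeSeq_eq_three_iff (n : ℤ) : palindromeFreeSeq n = 3 ↔ n % 3 = 2 := by
  unfold palindromeFreeSeq
  split_ifs with h
  · simp [h]
  · simp [h, thueMorseDiff_ne_three]

theorem palindromeFreeSeq_add_div_two (j : ℤ) :
    palindromeFreeSeq (j + j / 2) = thueMorseDiff j := by
  rw [palindromeFreeSeq, if_neg (by omega)]
  congr 1
  omega

theorem palindromeFreeSeq_ne_add_one (x : ℤ) :
    palindromeFreeSeq x ≠ palindromeFreeSeq (x + 1) := by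
  intro h
  have h₃ := palindromeFreeSeq_eq_three_iff x
  rw [h, palindromeFreeSeq_eq_three_iff] at h₃
  have hx : x = (x - x / 3) + (x - x / 3) / 2 := by omega
  have hx' : x + 1 = (x - x / 3 + 1) + (x - x / 3 + 1) / 2 := by omega
  rw [hx', palindromeFreeSeq_add_div_two, hx, palindromeFreeSeq_add_div_two, ← hx] at h
  exact thueMorseDiff_isSquareFreeSeq.ne_add_one _ h

/-- Equal terms at distance two cannot be `3`, so the inserted `3` lies between them and they are
consecutive terms of `thueMorseDiff`. -/
theorem palindromeFreeSeq_ne_add_two (x : ℤ) :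
    palindromeFreeSeq x ≠ palindromeFreeSeq (x + 2) := by
  intro h
  have h₃ := palindromeFreeSeq_eq_three_iff x
  rw [h, palindromeFreeSeq_eq_three_iff] at h₃
  have hx : x = (x - x / 3) + (x - x / 3) / 2 := by omega
  have hx' : x + 2 = (x - x / 3 + 1) + (x - x / 3 + 1) / 2 := by omega
  rw [hx', palindromeFreeSeq_add_div_two, hx, palindromeFreeSeq_add_div_two, ← hx] at h
  exact thueMorseDiff_isSquareFreeSeq.ne_add_one _ h

theorem palindromeFreeSeq_isSquareFreeSeq : IsSquareFreeSeq palindromeFreeSeq := by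
  intro a p hp h
  have hmod : ∀ i : ℕ, i < p → ((a + i) % 3 = 2 ↔ (a + p + i) % 3 = 2) := fun i hi => by
    rw [← palindromeFreeSeq_eq_three_iff, ← palindromeFreeSeq_eq_three_iff, h i hi]
  obtain rfl | rfl | hp₃ : p = 1 ∨ p = 2 ∨ 3 ≤ p := by omega
  · exact palindromeFreeSeq_ne_add_one a (by simpa using h 0 (by omega))
  · exact palindromeFreeSeq_ne_add_two a (by simpa using h 0 (by omega))
  -- Among three consecutive terms exactly one is `3`, and its copy is again a `3`.
  obtain ⟨q, rfl⟩ : 3 ∣ p := by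
    have h₀ := hmod 0 (by omega)
    have h₁ := hmod 1 (by omega)
    have h₂ := hmod 2 (by omega)
    push_cast at h₀ h₁ h₂
    omega
  -- Deleting the inserted letters leaves a square of period `2 * q`; `a - a / 3` indexes the first
  -- remaining term at or after position `a`.
  refine thueMorseDiff_isSquareFreeSeq (a - a / 3) (2 * q) (by omega) fun j hj => ?_
  obtain ⟨i, hi⟩ : ∃ i : ℕ, a + i = (a - a / 3 + j) + (a - a / 3 + j) / 2 :=
    ⟨((a - a / 3 + j) + (a - a / 3 + j) / 2 - a).toNat, by omega⟩
  have hi' := h i (by omega)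
  rw [hi, palindromeFreeSeq_add_div_two] at hi'
  rw [hi', ← palindromeFreeSeq_add_div_two]
  congr 1
  omega

theorem exists_isPalindromeFreeThue : ∃ T : ℤ → Fin 4, IsPalindromeFreeThue T :=
  ⟨palindromeFreeSeq, isPalindromeFreeThue_iff.mpr
    ⟨palindromeFreeSeq_isSquareFreeSeq, palindromeFreeSeq_ne_add_two⟩⟩

/-! ### The coloring of the tensor power -/

/-- A vertex whose last coordinate is odd is colored by `T` along the last coordinate and by the
second binary digits of the other coordinates; a vertex whose last coordinate is even is colored
by the sequences `S i` along the other coordinates. -/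
noncomputable def tensorColoring {m : ℕ} (T : ℤ → Fin 4) (S : Fin m → ℤ → Fin 4)
    (x : Fin (m + 1) → ℤ) : (Fin 4 × Fin (2 ^ m)) ⊕ (Fin m → Fin 4) :=
  if Odd (x (Fin.last m)) then
    Sum.inl (T ((x (Fin.last m) - 1) / 2),
      finFunctionFinEquiv fun i => if Even (x i.castSucc / 2) then 0 else 1)
  else Sum.inr fun i => S i (x i.castSucc / 2)

section Coloring

variable {m : ℕ} {T : ℤ → Fin 4} {S : Fin m → ℤ → Fin 4}

theorem odd_iff_odd_of_tensorColoring_eq {x y : Fin (m + 1) → ℤ}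
    (h : tensorColoring T S x = tensorColoring T S y) :
    Odd (x (Fin.last m)) ↔ Odd (y (Fin.last m)) := by
  unfold tensorColoring at h
  by_cases hx : Odd (x (Fin.last m)) <;> by_cases hy : Odd (y (Fin.last m)) <;>
    simp_all only [if_true, if_false, reduceCtorEq]

theorem eq_and_even_iff_of_tensorColoring_eq {x y : Fin (m + 1) → ℤ}
    (h : tensorColoring T S x = tensorColoring T S y) (hx : Odd (x (Fin.last m))) :
    T ((x (Fin.last m) - 1) / 2) = T ((y (Fin.last m) - 1) / 2) ∧
      ∀ i : Fin m, Even (x i.castSucc / 2) ↔ Even (y i.castSucc / 2) := by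
  have hy := (odd_iff_odd_of_tensorColoring_eq h).mp hx
  rw [tensorColoring, tensorColoring, if_pos hx, if_pos hy, Sum.inl.injEq, Prod.mk.injEq] at h
  refine ⟨h.1, fun i => ?_⟩
  have := congrFun (finFunctionFinEquiv.injective h.2) i
  by_cases hxi : Even (x i.castSucc / 2) <;> by_cases hyi : Even (y i.castSucc / 2) <;>
    simp only [hxi, hyi, if_true, if_false, zero_ne_one, one_ne_zero] at this ⊢

theorem eq_of_tensorColoring_eq_of_even {x y : Fin (m + 1) → ℤ}
    (h : tensorColoring T S x = tensorColoring T S y) (hx : Even (x (Fin.last m)))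
    (i : Fin m) : S i (x i.castSucc / 2) = S i (y i.castSucc / 2) := by
  have hx' := Int.not_odd_iff_even.mpr hx
  have hy := mt (odd_iff_odd_of_tensorColoring_eq h).mpr hx'
  rw [tensorColoring, tensorColoring, if_neg hx', if_neg hy, Sum.inr.injEq] at h
  exact congrFun h i

theorem tensorColoring_isNonrepetitive (hT : IsPalindromeFreeThue T)
    (hS : ∀ i, IsPalindromeFreeThue (S i)) :
    IsNonrepetitive (tensorPow infinitePath (m + 1)) (tensorColoring T S) := by
  intro u w p hp k hk hlen hrep
  rw [isPalindromeFreeThue_iff] at hT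
  simp only [isPalindromeFreeThue_iff] at hS
  set v := p.getVert
  have hstep : ∀ j, j + 1 < 2 * k → ∀ i,
      v (j + 1) i = v j i + 1 ∨ v j i = v (j + 1) i + 1 := fun j hj i =>
    infinitePath_adj.mp ((p.adj_getVert_succ (by omega)).2 i)
  have hparity : ∀ j, j < 2 * k → ∀ i, (v j i - v 0 i - j) % 2 = 0 := by
    intro j
    induction j with
    | zero => simp
    | succ j ih =>
      intro hj i
      have h₁ := ih (by omega) i
      have h₂ := hstep j hj i
      push_cast
      omega
  have hodd : ∀ i < k, (v i (Fin.last m) % 2 = 1 ↔ v (k + i) (Fin.last m) % 2 = 1) := by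
    intro i hi
    simpa only [Int.odd_iff] using odd_iff_odd_of_tensorColoring_eq (hrep i hi)
  -- Vertex types alternate along the path, and vertices `k` steps apart have the same type.
  obtain ⟨q, rfl⟩ : 2 ∣ k := by
    have h₀ := hodd 0 hk
    have h₁ := hparity (k + 0) (by omega) (Fin.last m)
    push_cast at h₁
    omega
  -- every second vertex of the path moves lazily in each halved coordinate
  have hlazy : ∀ (o : ℕ) (i) (d : ℤ), o < 2 →
      IsLazyWalk (fun j => (v (2 * j + o) i - d) / 2) (2 * q) := by
    intro o i d ho j hj
    have h₁ := hstep (2 * j + o) (by omega) i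
    have h₂ := hstep (2 * j + o + 1) (by omega) i
    simp only [show 2 * (j + 1) + o = 2 * j + o + 1 + 1 by ring]
    exact abs_le.mpr ⟨by omega, by omega⟩
  -- Halving loses nothing here: indices `o` and `2 * q + o` have equal parity, hence so do their
  -- coordinates.
  have hrepeat : ∀ (o : ℕ) (i) (d : ℤ) (R : ℤ → Fin 4), o < 2 →
      (IsSquareFreeSeq R ∧ ∀ x, R x ≠ R (x + 2)) →
      (∀ j < 2 * q, j % 2 = o → R ((v j i - d) / 2) = R ((v (2 * q + j) i - d) / 2)) →
      v o i = v (2 * q + o) i := by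
    intro o i d R ho hR h
    have h₁ := hR.1.eq_of_lazyWalk hR.2 (hlazy o i d ho) (fun j hj => by
      simpa only [show 2 * (q + j) + o = 2 * q + (2 * j + o) by ring] using
        h (2 * j + o) (by omega) (by omega)) 0 (by omega)
    have h₂ := hparity o (by omega) i
    have h₃ := hparity (2 * q + o) (by omega) i
    simp only [mul_zero, zero_add, add_zero] at h₁
    push_cast at h₃
    omega
  obtain ⟨o, ho, hoodd⟩ : ∃ o < 2, v o (Fin.last m) % 2 = 1 := by
    have h₁ := hparity 1 (by omega) (Fin.last m)
    push_cast at h₁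
    rcases Int.emod_two_eq_zero_or_one (v 0 (Fin.last m)) with h | h
    · exact ⟨1, by omega, by omega⟩
    · exact ⟨0, by omega, h⟩
  have hmod : ∀ j < 2 * q, (v j (Fin.last m) % 2 = 1 ↔ j % 2 = o) := by
    intro j hj
    have h₁ := hparity j (by omega) (Fin.last m)
    have h₂ := hparity o (by omega) (Fin.last m)
    omega
  have hlast : v o (Fin.last m) = v (2 * q + o) (Fin.last m) :=
    hrepeat o _ 1 T ho hT fun j hj hjo => (eq_and_even_iff_of_tensorColoring_eq (hrep j hj)
      (Int.odd_iff.mpr ((hmod j hj).mpr hjo))).1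
  have hinit : ∀ i : Fin m, v (1 - o) i.castSucc = v (2 * q + (1 - o)) i.castSucc := by
    intro i
    refine hrepeat (1 - o) _ 0 (S i) (by omega) (hS i) fun j hj hjo => ?_
    simp only [sub_zero]
    refine eq_of_tensorColoring_eq_of_even (hrep j hj) (Int.even_iff.mpr ?_) i
    have := hmod j hj
    omega
  -- In each remaining coordinate, `v o` and `v (2 * q + o)` are both neighbors of the common value
  -- given by `hinit`. Two distinct neighbors would differ by 2, and their halves would have
  -- opposite parities, against `h₁`.
  have heq : v o = v (2 * q + o) := by
    funext i
    induction i using Fin.lastCases with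
    | last => exact hlast
    | cast i =>
      have h₁ := (eq_and_even_iff_of_tensorColoring_eq (hrep o (by omega))
        (Int.odd_iff.mpr hoodd)).2 i
      have h₂ := hinit i
      have h₃ := hstep 0 (by omega) i.castSucc
      have h₄ := hstep (2 * q + 0) (by omega) i.castSucc
      have h₅ := hparity o (by omega) i.castSucc
      have h₆ := hparity (2 * q + o) (by omega) i.castSucc
      rw [Int.even_iff, Int.even_iff] at h₁
      obtain rfl | rfl : o = 0 ∨ o = 1 := by omega
      · simp only [tsub_zero, add_zero, zero_add] at *
        push_cast at h₆
        omega
      · simp only [Nat.sub_self, add_zero, zero_add] at *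
        push_cast at h₆
        omega
  have := hp.getVert_injOn (show o ∈ {i | i ≤ p.length} by simp only [Set.mem_ofPred_eq]; omega)
    (show 2 * q + o ∈ {i | i ≤ p.length} by simp only [Set.mem_ofPred_eq]; omega) heq
  omega

end Coloring

/-! ### From a nonrepetitive coloring to a bound on the Thue number -/

theorem IsNonrepetitive.comp_injective {V α β : Type*} {G : SimpleGraph V} {c : V → α}
    (hc : IsNonrepetitive G c) {f : α → β} (hf : Function.Injective f) :
    IsNonrepetitive G (f ∘ c) :=
  fun _ _ p hp k hk hlen h => hc p hp k hk hlen fun i hi => hf (h i hi)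

theorem thueNumber_le_card {V α : Type*} [Fintype α] {G : SimpleGraph V} {c : V → α}
    (hc : IsNonrepetitive G c) : thueNumber G ≤ (Fintype.card α : ℕ∞) :=
  iInf₂_le (Fintype.card α) ⟨_, hc.comp_injective (Fintype.equivFin α).injective⟩

theorem theorem4 (n : ℕ) (hn : 1 ≤ n) :
    thueNumber (tensorPow infinitePath n) ≤ ((4 ^ (n - 1) + 4 * 2 ^ (n - 1) : ℕ) : ℕ∞) ∧
    (∃ T : ℤ → Fin 4, IsPalindromeFreeThue T) ∧
    ∀ (T : ℤ → Fin 4) (S : Fin (n - 1) → ℤ → Fin 4),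
      IsPalindromeFreeThue T → (∀ i, IsPalindromeFreeThue (S i)) →
      ∃ c : (Fin n → ℤ) → (Fin 4 × Fin (2 ^ (n - 1))) ⊕ (Fin (n - 1) → Fin 4),
        IsNonrepetitive (tensorPow infinitePath n) c ∧
        (∀ x : Fin n → ℤ, Odd (x ⟨n - 1, Nat.sub_one_lt_of_lt hn⟩) →
          ∃ r : Fin (2 ^ (n - 1)),
            c x = Sum.inl (T ((x ⟨n - 1, Nat.sub_one_lt_of_lt hn⟩ - 1) / 2), r)) ∧
        (∀ x : Fin n → ℤ, Even (x ⟨n - 1, Nat.sub_one_lt_of_lt hn⟩) →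
          c x = Sum.inr (fun i => S i (x (Fin.castLE (Nat.sub_le n 1) i) / 2))) := by
  obtain ⟨m, rfl⟩ : ∃ m, n = m + 1 := ⟨n - 1, by omega⟩
  obtain ⟨T₀, hT₀⟩ := exists_isPalindromeFreeThue
  refine ⟨?_, ⟨T₀, hT₀⟩, fun T S hT hS => ⟨tensorColoring (m := m) T S,
    tensorColoring_isNonrepetitive hT hS, fun x hx => ⟨_, if_pos hx⟩,
    fun x hx => if_neg (Int.not_odd_iff_even.mpr hx)⟩⟩
  refine (thueNumber_le_card
    (tensorColoring_isNonrepetitive (m := m) hT₀ fun _ => hT₀)).trans_eq ?_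
  simp [add_comm]
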